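/- For a pointed set $(X,1)$ put $X^*=X\setminus\{1\}$ and let $\tilde X^*$ be a disjoint copy of $X^*$. The free partial group $\mathbb{X}$ on $(X,1)$ has underlying set $\{1\}\sqcup X^*\sqcup\tilde X^*$, with inversion $1\mapsto 1$, $x\leftrightarrow\tilde x$; its product is defined on the words that are alternating strings $(\ldots,x,\tilde x,x,\tilde x,\ldots)$ in one $x\in X^*$ (possibly empty) with finitely many letters $1$ inserted anywhere, and its value is $x$, $1$ or $\tilde x$ according to whether the number of letters $x$ is greater than, equal to or less than the number of letters $\tilde x$. A partial group is regarded as a simplicial set whose $n$-simplices are the words of length $n$ in its domain, with inner faces multiplying adjacent letters, outer faces deleting the first or last letter, and degeneracies inserting $1$. An extension of a partial group $\mathbb{H}$ by a partial group $\mathbb{M}$ is a sequence of simplicial maps $\mathbb{M}\xrightarrow{\iota}\mathbb{E}\xrightarrow{\tau}\mathbb{H}$ in which $\tau$ is a fibre bundle with fibre $\mathbb{M}$ (i.e. $\tau$ is surjective, and for every simplex $b\colon\Delta[n]\to\mathbb{H}$ the pullback of $\tau$ along $b$ is isomorphic to $\mathbb{M}\times\Delta[n]$ over $\Delta[n]$)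 and $\iota$ is an isomorphism of $\mathbb{M}$ onto the fibre of $\tau$ over the unique vertex of $\mathbb{H}$. Two extensions $\mathbb{M}\to\mathbb{E}_i\to\mathbb{H}$, $i=1,2$, are equivalent if there is an isomorphism $\psi\colon\mathbb{E}_1\to\mathbb{E}_2$ with $\psi\circ\iota_1=\iota_2$ and $\tau_2\circ\psi=\tau_1$. **Proposition.** Let $(X,1)$ and $(Y,1)$ be finite pointed sets with associated free partial groups $\mathbb{X}$ and $\mathbb{Y}$. Then the number of equivalence classes of extensions of $\mathbb{X}$ by $\mathbb{Y}$ is $$\bigl(|Y^*|!\;2^{|Y^*|}\bigr)^{|X^*|}.$$ -/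

import Mathlib

open CategoryTheory MonoidalCategory CartesianMonoidalCategory
open scoped Simplicial

universe u

/-- A partial group with underlying set `M`: a set `dom` of words in `M` on which an associative
product is defined, together with an inversion. -/
structure PartialGroup (M : Type u) where
  nonempty : Nonempty M
  /-- the domain of the product, a set of words -/
  dom : Set (List M)
  singleton_mem : ∀ x : M, [x] ∈ dom
  left_mem : ∀ u v : List M, u ++ v ∈ dom → u ∈ dom
  right_mem : ∀ u v : List M, u ++ v ∈ dom → v ∈ dom
  /-- the product, defined on `dom` only -/
  prod : ∀ w : List M, w ∈ dom → M
  prod_singleton : ∀ x : M, prod [x] (singleton_mem x) = x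
  subst_mem : ∀ (u v w : List M) (h : u ++ v ++ w ∈ dom),
    u ++ [prod v (right_mem u v (left_mem (u ++ v) w h))] ++ w ∈ dom
  prod_subst : ∀ (u v w : List M) (h : u ++ v ++ w ∈ dom),
    prod (u ++ v ++ w) h =
      prod (u ++ [prod v (right_mem u v (left_mem (u ++ v) w h))] ++ w) (subst_mem u v w h)
  inv : M → M
  inv_inv : ∀ x : M, inv (inv x) = x
  inv_append_mem : ∀ u : List M, u ∈ dom → (u.map inv).reverse ++ u ∈ dom
  /-- `Π (u⁻¹ ∘ u) = 1`, where the unit is the product of the empty word -/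
  prod_inv_append : ∀ (u : List M) (hu : u ∈ dom),
    prod ((u.map inv).reverse ++ u) (inv_append_mem u hu) =
      prod [] (right_mem u [] (u.append_nil.symm ▸ hu))

namespace PartialGroup

variable {M : Type u} (P : PartialGroup M)

theorem nil_mem : [] ∈ P.dom := by
  obtain ⟨x⟩ := P.nonempty
  exact P.left_mem [] [x] (P.singleton_mem x)

/-- The subword of `w` with letters in the positions `a + 1, …, b`. -/
def slice (w : List M) (a b : ℕ) : List M := (w.take b).drop a

theorem slice_mem {w : List M} (hw : w ∈ P.dom) (a b : ℕ) : slice w a b ∈ P.dom := by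
  have h1 : w.take b ∈ P.dom :=
    P.left_mem (w.take b) (w.drop b) (by rw [List.take_append_drop]; exact hw)
  exact P.right_mem ((w.take b).take a) _ (by rw [slice, List.take_append_drop]; exact h1)

theorem prod_congr {v w : List M} (h : v = w) (hv : v ∈ P.dom) :
    P.prod v hv = P.prod w (h ▸ hv) := by
  subst h; rfl

/-- The product of the letters of `w` in the positions `a + 1, …, b`. -/
def sliceProd (w : List M) (hw : w ∈ P.dom) (a b : ℕ) : M :=
  P.prod (slice w a b) (P.slice_mem hw a b)

theorem blocks_mem (w : List M) (hw : w ∈ P.dom) (F : ℕ → ℕ) (hF : Monotone F) :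
    ∀ (c a : ℕ) (u : List M), ∀ hu : u ++ slice w (F a) (F (a + c)) ∈ P.dom,
      ∃ h : u ++ (List.range' a c).map (fun i => P.sliceProd w hw (F i) (F (i + 1))) ∈ P.dom,
        P.prod _ hu = P.prod _ h := by
  intro c
  induction c with
  | zero =>
    intro a u hu
    have e : slice w (F a) (F (a + 0)) = [] := by simp [slice]
    have e' : u ++ slice w (F a) (F (a + 0)) = u ++
      (List.range' a 0).map (fun i => P.sliceProd w hw (F i) (F (i + 1))) := by rw [e]; rfl
    exact ⟨e' ▸ hu, P.prod_congr e' hu⟩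
  | succ c ih =>
    intro a u hu
    have e : slice w (F a) (F (a + (c + 1))) =
        slice w (F a) (F (a + 1)) ++ slice w (F (a + 1)) (F (a + 1 + c)) := by
      have h1 : F a ≤ F (a + 1) := hF (by omega)
      have h2 : F (a + 1) ≤ F (a + 1 + c) := hF (by omega)
      rw [show a + (c + 1) = a + 1 + c by omega]
      simp only [slice]
      generalize F a = p at *
      generalize F (a + 1) = q at *
      generalize F (a + 1 + c) = r at *
      rw [List.drop_take, List.drop_take, List.drop_take, show r - p = (q - p) + (r - q) by omega,
        List.take_add, List.drop_drop, show p + (q - p) = q by omega]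
    have e1 : u ++ slice w (F a) (F (a + (c + 1))) =
        u ++ slice w (F a) (F (a + 1)) ++ slice w (F (a + 1)) (F (a + 1 + c)) := by
      rw [e, List.append_assoc]
    have hu1 := hu
    rw [e1] at hu1
    obtain ⟨h3, h4⟩ := ih (a + 1) (u ++ [P.sliceProd w hw (F a) (F (a + 1))])
      (P.subst_mem _ _ _ hu1)
    have e2 : u ++ [P.sliceProd w hw (F a) (F (a + 1))] ++
        (List.range' (a + 1) c).map (fun i => P.sliceProd w hw (F i) (F (i + 1))) =
        u ++ (List.range' a (c + 1)).map (fun i => P.sliceProd w hw (F i) (F (i + 1))) := by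
      rw [List.range'_succ, List.map_cons, List.append_assoc]; rfl
    refine ⟨e2 ▸ h3, ?_⟩
    rw [P.prod_congr e1 hu, P.prod_subst _ _ _ hu1]
    exact h4.trans (P.prod_congr e2 h3)

/-- The word `(x₁, …, xₘ)` in which `xⱼ` is the product of the letters of `w` in the positions
`f (j - 1) + 1, …, f j`. -/
def pull (w : List M) (hw : w ∈ P.dom) {m n : ℕ} (f : Fin (m + 1) →o Fin (n + 1)) : List M :=
  List.ofFn fun j : Fin m => P.sliceProd w hw (f j.castSucc) (f j.succ)

/-- A monotone extension to `ℕ` of a monotone map between finite ordinals. -/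
def extend {m n : ℕ} (f : Fin (m + 1) →o Fin (n + 1)) (i : ℕ) : ℕ :=
  f ⟨min i m, by omega⟩

theorem extend_mono {m n : ℕ} (f : Fin (m + 1) →o Fin (n + 1)) : Monotone (extend f) := by
  intro a b h
  exact f.monotone (by simp only [Fin.mk_le_mk]; omega)

theorem extend_eq {m n : ℕ} (f : Fin (m + 1) →o Fin (n + 1)) (i : Fin (m + 1)) :
    extend f i = f i := by
  have h : (⟨min (i : ℕ) m, by omega⟩ : Fin (m + 1)) = i :=
    Fin.ext (Nat.min_eq_left (by omega))
  rw [extend, h]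

theorem pull_eq (w : List M) (hw : w ∈ P.dom) {m n : ℕ} (f : Fin (m + 1) →o Fin (n + 1)) :
    P.pull w hw f = (List.range' 0 m).map
      (fun i => P.sliceProd w hw (extend f i) (extend f (i + 1))) := by
  apply List.ext_getElem
  · simp [pull]
  · intro i h1 h2
    have hi : i < m := by simpa [pull] using h1
    have a1 := extend_eq f (Fin.castSucc ⟨i, hi⟩)
    have a2 := extend_eq f (Fin.succ ⟨i, hi⟩)
    simp only [Fin.val_castSucc, Fin.val_succ] at a1 a2
    simp [pull, a1, a2]

theorem pull_mem (w : List M) (hw : w ∈ P.dom) {m n : ℕ} (f : Fin (m + 1) →o Fin (n + 1)) :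
    P.pull w hw f ∈ P.dom := by
  rw [pull_eq]
  exact (P.blocks_mem w hw (extend f) (extend_mono f) m 0 [] (P.slice_mem hw _ _)).1

theorem pull_length (w : List M) (hw : w ∈ P.dom) {m n : ℕ} (f : Fin (m + 1) →o Fin (n + 1)) :
    (P.pull w hw f).length = m := by
  simp [pull]

theorem pull_id (w : List M) (hw : w ∈ P.dom) {n : ℕ} (hn : w.length = n) :
    P.pull w hw (OrderHom.id : Fin (n + 1) →o Fin (n + 1)) = w := by
  apply List.ext_getElem
  · simp [pull, hn]
  · intro i h1 h2
    have e : slice w i (i + 1) = [w[i]] := by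
      rw [slice, List.drop_take, List.drop_eq_getElem_cons h2, Nat.add_sub_cancel_left]
      rfl
    simp only [pull, sliceProd, List.getElem_ofFn, OrderHom.id_coe, id_eq, Fin.val_castSucc,
      Fin.val_succ]
    rw [P.prod_congr e]
    exact P.prod_singleton _

theorem pull_comp (w : List M) (hw : w ∈ P.dom) {k m n : ℕ} (f : Fin (m + 1) →o Fin (n + 1))
    (g : Fin (k + 1) →o Fin (m + 1)) :
    P.pull w hw (f.comp g) = P.pull (P.pull w hw f) (P.pull_mem w hw f) g := by
  apply List.ext_getElem
  · simp [pull]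
  · intro i h1 h2
    have hi : i < k := by simpa [pull] using h1
    simp only [pull, List.getElem_ofFn]
    change P.sliceProd w hw (f (g (Fin.castSucc ⟨i, hi⟩))) (f (g (Fin.succ ⟨i, hi⟩))) =
      P.sliceProd (P.pull w hw f) (P.pull_mem w hw f) (g (Fin.castSucc ⟨i, hi⟩))
        (g (Fin.succ ⟨i, hi⟩))
    have hle : g (Fin.castSucc ⟨i, hi⟩) ≤ g (Fin.succ ⟨i, hi⟩) :=
      g.monotone (Fin.castSucc_lt_succ).le
    generalize g (Fin.castSucc ⟨i, hi⟩) = a at *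
    generalize g (Fin.succ ⟨i, hi⟩) = b at *
    have hab : (a : ℕ) ≤ b := hle
    obtain ⟨c, hc⟩ := Nat.exists_eq_add_of_le hab
    have e0 : slice w (f a) (f b) = [] ++ slice w (extend f a) (extend f (a + c)) := by
      rw [← hc, extend_eq, extend_eq]; rfl
    have e1 : slice (P.pull w hw f) a b = [] ++
        (List.range' a c).map (fun i => P.sliceProd w hw (extend f i) (extend f (i + 1))) := by
      rw [pull_eq, slice, ← List.map_take, ← List.map_drop, List.nil_append]
      congr 1
      apply List.ext_getElem
      · simp; omega
      · intro j h3 h4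
        simp
    obtain ⟨h5, h6⟩ := P.blocks_mem w hw (extend f) (extend_mono f) c a []
      (P.slice_mem hw _ _)
    rw [sliceProd, sliceProd, P.prod_congr e0, P.prod_congr e1]
    exact h6

/-- The simplicial set of a partial group. The `n`-simplices are the words of length `n` in the
domain; inner faces multiply adjacent letters, outer faces delete the first or the last letter,
and degeneracies insert the unit. -/
def toSSet : SSet.{u} where
  obj n := {w : List M // w ∈ P.dom ∧ w.length = n.unop.len}
  map f := ↾fun w => ⟨P.pull w.1 w.2.1 f.unop.toOrderHom, P.pull_mem _ _ _, P.pull_length _ _ _⟩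
  map_id n := by
    apply ConcreteCategory.hom_ext
    intro w
    exact Subtype.ext (P.pull_id w.1 w.2.1 w.2.2)
  map_comp f g := by
    apply ConcreteCategory.hom_ext
    intro w
    exact Subtype.ext (P.pull_comp w.1 w.2.1 f.unop.toOrderHom g.unop.toOrderHom)

/-- The unique vertex of the simplicial set of a partial group. -/
def vertex : P.toSSet _⦋0⦌ := ⟨[], P.nil_mem, rfl⟩

end PartialGroup

namespace FreePartialGroup

/-- The set `{1} ⊔ X* ⊔ X̃*` with `X* = X ∖ {x₀}`: `none` is `1`, `some (x, true)` is `x`, and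
`some (x, false)` is the formal inverse `x̃`. -/
abbrev Carrier (X : Type u) (x₀ : X) : Type u := Option ({x : X // x ≠ x₀} × Bool)

variable {X : Type u} {x₀ : X}

/-- Exchange `x` and `x̃`. -/
def bar (a : {x : X // x ≠ x₀} × Bool) : {x : X // x ≠ x₀} × Bool := (a.1, !a.2)

theorem bar_bar (a : {x : X // x ≠ x₀} × Bool) : bar (bar a) = a := by
  simp [bar]

/-- The words which, after deleting all letters `1`, are alternating strings
`(…, x, x̃, x, x̃, …)` for a single `x`. -/
def dom (X : Type u) (x₀ : X) : Set (List (Carrier X x₀)) :=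
  {w | w.reduceOption.IsChain fun a b => b = bar a}

/-- The product of an alternating string: `x` or `x̃`, whichever occurs more often, and `1` if they
occur equally often. In an alternating string the two numbers differ exactly if the length is odd,
and then the first letter is the one that occurs more often. -/
def altProd (l : List ({x : X // x ≠ x₀} × Bool)) : Carrier X x₀ :=
  if Even l.length then none else l.head?

/-- The alternating string of length `n` that starts with `a`. -/
def altWord (a : {x : X // x ≠ x₀} × Bool) (n : ℕ) : List ({x : X // x ≠ x₀} × Bool) :=
  match n with
  | 0 => []
  | n + 1 => a :: altWord (bar a) n

theorem alt_length (n : ℕ) : ∀ a : {x : X // x ≠ x₀} × Bool, (altWord a n).length = n := by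
  induction n with
  | zero => intro a; rfl
  | succ n ih => intro a; simp [altWord, ih]

theorem alt_isChain (n : ℕ) : ∀ a : {x : X // x ≠ x₀} × Bool,
    (altWord a n).IsChain fun a b => b = bar a := by
  induction n with
  | zero => intro a; simp [altWord]
  | succ n ih =>
    intro a
    cases n with
    | zero => simp [altWord]
    | succ n => exact List.IsChain.cons_cons rfl (ih (bar a))

theorem eq_alt : ∀ (l : List ({x : X // x ≠ x₀} × Bool)) (a : {x : X // x ≠ x₀} × Bool),
    ((a :: l).IsChain fun a b => b = bar a) → a :: l = altWord a (l.length + 1) := by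
  intro l
  induction l with
  | nil => intro a _; rfl
  | cons b l ih =>
    intro a h
    rw [List.isChain_cons_cons] at h
    obtain ⟨rfl, h⟩ := h
    exact congrArg (List.cons a) (ih _ h)

theorem alt_add (m : ℕ) : ∀ (n : ℕ) (a : {x : X // x ≠ x₀} × Bool),
    altWord a (m + n) = altWord a m ++ altWord (bar^[m] a) n := by
  induction m with
  | zero => intro n a; simp [altWord]
  | succ m ih =>
    intro n a
    rw [show m + 1 + n = (m + n) + 1 by omega, altWord, ih, altWord]
    rfl

theorem altProd_alt (a : {x : X // x ≠ x₀} × Bool) (n : ℕ) :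
    altProd (altWord a n) = if Even n then none else some a := by
  cases n with
  | zero => rfl
  | succ n => simp [altProd, altWord, alt_length]

theorem bar_iterate (a : {x : X // x ≠ x₀} × Bool) (n : ℕ) :
    bar^[n] a = if Even n then a else bar a := by
  induction n with
  | zero => rfl
  | succ n ih =>
    rw [Function.iterate_succ_apply', ih]
    by_cases h : Even n
    · simp [h, Nat.even_add_one]
    · simp [h, Nat.even_add_one, bar_bar]

theorem altProd_toList (a : {x : X // x ≠ x₀} × Bool) (n : ℕ) :
    (altProd (altWord a n)).toList = altWord a (n % 2) := by
  rw [altProd_alt]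
  rcases Nat.even_or_odd n with h | h
  · simp [h, Nat.even_iff.1 h, altWord]
  · simp [Nat.not_even_iff_odd.2 h, Nat.odd_iff.1 h, altWord]

/-- Replacing a factor of an alternating string by its product. -/
theorem alt_subst (u v w : List ({x : X // x ≠ x₀} × Bool))
    (h : (u ++ v ++ w).IsChain fun a b => b = bar a) :
    ((u ++ (altProd v).toList ++ w).IsChain fun a b => b = bar a) ∧
      altProd (u ++ v ++ w) = altProd (u ++ (altProd v).toList ++ w) := by
  rcases hl : u ++ v ++ w with _ | ⟨a, l⟩
  · simp only [List.append_eq_nil_iff] at hl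
    obtain ⟨⟨rfl, rfl⟩, rfl⟩ := hl
    simp [altProd]
  · have e := eq_alt l a (hl ▸ h)
    rw [← hl] at e
    have hlen : l.length + 1 = u.length + v.length + w.length := by
      have := congrArg List.length hl
      simp only [List.length_append, List.length_cons] at this
      omega
    rw [hlen, alt_add, alt_add] at e
    obtain ⟨e1, ew⟩ := List.append_inj e (by simp [alt_length])
    obtain ⟨eu, ev⟩ := List.append_inj e1 (by simp [alt_length])
    generalize u.length = p at *
    generalize v.length = q at *
    generalize w.length = r at *
    subst eu ev ew
    have hp : bar^[p + q % 2] a = bar^[p + q] a := by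
      rw [bar_iterate, bar_iterate]
      have : Even (p + q % 2) ↔ Even (p + q) := by
        rw [Nat.even_iff, Nat.even_iff]; omega
      simp only [this]
    have key : altWord a p ++ (altProd (altWord (bar^[p] a) q)).toList ++ altWord (bar^[p + q] a) r =
        altWord a (p + q % 2 + r) := by
      rw [altProd_toList, alt_add, alt_add, hp]
    rw [key]
    refine ⟨alt_isChain _ _, ?_⟩
    rw [← hl, ← alt_add, ← alt_add, altProd_alt, altProd_alt]
    have : Even (p + q + r) ↔ Even (p + q % 2 + r) := by
      rw [Nat.even_iff, Nat.even_iff]; omega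
    simp only [this]

theorem reduceOption_inv (w : List (Carrier X x₀)) :
    ((w.map (Option.map bar)).reverse).reduceOption = (w.reduceOption.map bar).reverse := by
  induction w with
  | nil => rfl
  | cons a w ih =>
    rw [List.map_cons, List.reverse_cons, List.reduceOption_append, ih]
    cases a <;> simp [List.reduceOption]

theorem inv_chain (l : List ({x : X // x ≠ x₀} × Bool))
    (h : l.IsChain fun a b => b = bar a) :
    ((l.map bar).reverse ++ l).IsChain fun a b => b = bar a := by
  rw [List.isChain_append]
  refine ⟨?_, h, ?_⟩
  · rw [List.isChain_reverse, List.isChain_map]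
    refine h.imp ?_
    rintro a b rfl
    simp [bar_bar]
  · intro x hx y hy
    cases l with
    | nil => simp at hy
    | cons a l =>
      simp at hx hy
      subst hx hy
      exact (bar_bar _).symm

end FreePartialGroup

open FreePartialGroup in
/-- The free partial group on the pointed set `(X, x₀)`. -/
def freePartialGroup (X : Type u) (x₀ : X) : PartialGroup (Carrier X x₀) where
  nonempty := ⟨none⟩
  dom := dom X x₀
  singleton_mem x := by cases x <;> simp [dom, List.reduceOption]
  left_mem u v h := by
    simp only [dom, Set.mem_ofPred_eq, List.reduceOption_append] at h ⊢
    exact h.left_of_append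
  right_mem u v h := by
    simp only [dom, Set.mem_ofPred_eq, List.reduceOption_append] at h ⊢
    exact h.right_of_append
  prod w _ := altProd w.reduceOption
  prod_singleton x := by cases x <;> simp [altProd, List.reduceOption]
  subst_mem u v w h := by
    simp only [dom, Set.mem_ofPred_eq, List.reduceOption_append,
      List.reduceOption_singleton] at h ⊢
    exact (alt_subst _ _ _ h).1
  prod_subst u v w h := by
    simp only [dom, Set.mem_ofPred_eq, List.reduceOption_append,
      List.reduceOption_singleton] at h ⊢
    exact (alt_subst _ _ _ h).2
  inv := Option.map bar
  inv_inv x := by cases x <;> simp [bar_bar]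
  inv_append_mem u h := by
    simp only [dom, Set.mem_ofPred_eq, List.reduceOption_append] at h ⊢
    rw [reduceOption_inv]
    exact inv_chain _ h
  prod_inv_append u h := by
    simp [List.reduceOption_append, reduceOption_inv, altProd]

/-- `τ : E ⟶ B` is a fibre bundle with fibre `F`: it is surjective, and for every simplex
`b : Δ[n] ⟶ B` the pullback of `τ` along `b` is isomorphic to `F × Δ[n]` over `Δ[n]`, that is,
the projection `F × Δ[n] ⟶ Δ[n]` is a pullback of `τ` along `b`. -/
structure IsFibreBundle (F : SSet.{u}) {E B : SSet.{u}} (τ : E ⟶ B) : Prop where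
  surjective : ∀ n, Function.Surjective (τ.app n)
  locallyTrivial : ∀ (n : ℕ) (b : Δ[n] ⟶ B),
    ∃ φ : F ⊗ Δ[n] ⟶ E, IsPullback φ (snd F Δ[n]) τ b

/-- An extension `M ⟶ E ⟶ H` of the partial group `H` by the partial group `M`: a fibre bundle
`τ : E ⟶ H` with fibre `M`, together with the identification `ι` of `M` with the fibre of `τ` over
the unique vertex of `H`. -/
structure PartialGroupExtension {A B : Type u} (H : PartialGroup A) (M : PartialGroup B) where
  E : SSet.{u}
  ι : M.toSSet ⟶ E
  τ : E ⟶ H.toSSet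
  isFibreBundle : IsFibreBundle M.toSSet τ
  isPullback : IsPullback ι (SSet.stdSimplex.isTerminalObj₀.from M.toSSet) τ
    (SSet.yonedaEquiv.symm H.vertex : Δ[0] ⟶ H.toSSet)

/-- Two extensions are equivalent if there is an isomorphism of the total spaces that is compatible
with the maps from `M` and to `H`. -/
def PartialGroupExtension.setoid {A B : Type u} (H : PartialGroup A) (M : PartialGroup B) :
    Setoid (PartialGroupExtension H M) where
  r e₁ e₂ := ∃ ψ : e₁.E ≅ e₂.E, e₁.ι ≫ ψ.hom = e₂.ι ∧ ψ.hom ≫ e₂.τ = e₁.τ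
  iseqv :=
    { refl := fun e => ⟨Iso.refl _, by simp, by simp⟩
      symm := by
        rintro e₁ e₂ ⟨ψ, h₁, h₂⟩
        exact ⟨ψ.symm, by simp [← h₁], by simp [← h₂]⟩
      trans := by
        rintro e₁ e₂ e₃ ⟨ψ, h₁, h₂⟩ ⟨χ, k₁, k₂⟩
        exact ⟨ψ ≪≫ χ, by simp [← k₁, ← h₁], by simp [← k₂, ← h₂]⟩ }

/-- The equivalence classes of extensions of `H` by `M`. -/
def ExtensionClasses {A B : Type u} (H : PartialGroup A) (M : PartialGroup B) : Type (u + 1) :=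
  Quotient (PartialGroupExtension.setoid H M)

/-! Extensions are classified by their monodromy, as covering spaces are. The fibre is rigid: a
family of self-maps of $\mathbb{Y}$ parametrized by $\Delta[n]$ and invertible at the vertices is
constant (`FreePartialGroup.rigid`). Hence two trivializations over a simplex differ by a single
automorphism of the fibre, and there is exactly one that restricts to $\iota$ over the initial
vertex (`IsNormalized.unique`). Its value at the other vertices gives a transport along edges that
turns products of the base into composites, a `Monodromy`. Conversely, a monodromy twists the
product of base and fibre into an extension. Since an equivalence has to respect $\iota$, the
monodromy is an invariant on the nose and not just up to conjugation, so that `classesEquiv` is a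
bijection.

In a free partial group two nontrivial letters multiply only if they are mutually inverse. A
monodromy of $\mathbb{X}$ is therefore an arbitrary choice of one automorphism of $\mathbb{Y}$ for
each element of $X^*$ (`monodromyEquiv`), and an automorphism of $\mathbb{Y}$ is a permutation of
the letters that commutes with inversion, i.e. a signed permutation of $Y^*$ (`card_aut`). -/

namespace PartialGroup

/-! ### Products of consecutive letters -/

variable {M : Type u} (P : PartialGroup M)

theorem sliceProd_pull (w : List M) (hw : w ∈ P.dom) {m n : ℕ} (f : Fin (m + 1) →o Fin (n + 1))
    {a b : Fin (m + 1)} (hab : a ≤ b) :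
    P.sliceProd (P.pull w hw f) (P.pull_mem w hw f) a b = P.sliceProd w hw (f a) (f b) := by
  obtain ⟨c, hc⟩ := Nat.exists_eq_add_of_le (show (a : ℕ) ≤ b from hab)
  have e0 : slice w (f a) (f b) = [] ++ slice w (extend f a) (extend f (a + c)) := by
    rw [← hc, extend_eq, extend_eq]; rfl
  have e1 : slice (P.pull w hw f) a b = [] ++
      (List.range' a c).map (fun i => P.sliceProd w hw (extend f i) (extend f (i + 1))) := by
    rw [pull_eq, slice, ← List.map_take, ← List.map_drop, List.nil_append]
    congr 1
    apply List.ext_getElem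
    · simp; omega
    · intro j h3 h4
      simp
  obtain ⟨h5, h6⟩ := P.blocks_mem w hw (extend f) (extend_mono f) c a [] (P.slice_mem hw _ _)
  rw [sliceProd, sliceProd, P.prod_congr e0, P.prod_congr e1]
  exact h6.symm

theorem slice_append (w : List M) {a b c : ℕ} (hab : a ≤ b) (hbc : b ≤ c) :
    slice w a c = slice w a b ++ slice w b c := by
  simp only [slice]
  rw [List.drop_take, List.drop_take, List.drop_take, show c - a = (b - a) + (c - b) by omega,
    List.take_add, List.drop_drop, show a + (b - a) = b by omega]

theorem prod_append {u v : List M} (h : u ++ v ∈ P.dom) :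
    ∃ h' : [P.prod u (P.left_mem u v h), P.prod v (P.right_mem u v h)] ∈ P.dom,
      P.prod (u ++ v) h = P.prod _ h' := by
  have h0 : [] ++ u ++ v ∈ P.dom := h
  have h1 := P.subst_mem [] u v h0
  have e1 := P.prod_subst [] u v h0
  have h2 : [P.prod u (P.left_mem u v h)] ++ v ++ [] ∈ P.dom := by
    rw [List.append_nil]; exact h1
  have e2 := P.prod_subst _ v [] h2
  refine ⟨P.subst_mem _ v [] h2, ?_⟩
  refine Eq.trans e1 (Eq.trans (P.prod_congr ?_ h1) e2)
  rw [List.append_nil]; rfl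

/-- The unit of a partial group. -/
def one : M := P.prod [] P.nil_mem

theorem one_one : ∃ h : [P.one, P.one] ∈ P.dom, P.prod _ h = P.one := by
  obtain ⟨h, e⟩ := P.prod_append (u := []) (v := []) P.nil_mem
  exact ⟨h, e.symm⟩

theorem sliceProd_self (w : List M) (hw : w ∈ P.dom) (a : ℕ) : P.sliceProd w hw a a = P.one :=
  P.prod_congr (by simp [slice]) _

theorem sliceProd_append (w : List M) (hw : w ∈ P.dom) {a b c : ℕ} (hab : a ≤ b) (hbc : b ≤ c) :
    ∃ h : [P.sliceProd w hw a b, P.sliceProd w hw b c] ∈ P.dom,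
      P.sliceProd w hw a c = P.prod _ h := by
  have e := slice_append w hab hbc
  obtain ⟨h', e'⟩ := P.prod_append (e ▸ P.slice_mem hw a c)
  exact ⟨h', (P.prod_congr e _).trans e'⟩

end PartialGroup

/-! ### Monodromy representations and twisted products -/

/-- A representation of a partial group by automorphisms of a simplicial set, with composition in
diagrammatic order. -/
@[ext]
structure Monodromy {A : Type u} (H : PartialGroup A) (F : SSet.{u}) where
  aut : A → (F ≅ F)
  aut_prod : ∀ (x y : A) (h : [x, y] ∈ H.dom), aut (H.prod _ h) = aut x ≪≫ aut y

namespace Monodromy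

variable {A : Type u} {H : PartialGroup A} {F : SSet.{u}} (α : Monodromy H F)

/-- From $1\cdot 1=1$ the automorphism attached to the unit is idempotent, and an invertible
idempotent is the identity. -/
theorem aut_one : α.aut H.one = Iso.refl F := by
  obtain ⟨h, e⟩ := H.one_one
  have h1 := α.aut_prod _ _ h
  rw [e] at h1
  have h2 := congrArg (fun g => (α.aut H.one).symm ≪≫ g) h1
  simp only [Iso.symm_self_id, Iso.symm_self_id_assoc] at h2
  exact h2.symm

/-- The automorphism attached to the edge from the vertex `a` to the vertex `b` of a simplex. -/
def edge {n : SimplexCategoryᵒᵖ} (w : H.toSSet.obj n) (a b : ℕ) : F ≅ F :=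
  α.aut (H.sliceProd w.1 w.2.1 a b)

theorem edge_self {n : SimplexCategoryᵒᵖ} (w : H.toSSet.obj n) (a : ℕ) :
    α.edge w a a = Iso.refl F := by
  rw [edge, H.sliceProd_self, aut_one]

theorem edge_trans {n : SimplexCategoryᵒᵖ} (w : H.toSSet.obj n) {a b c : ℕ} (hab : a ≤ b)
    (hbc : b ≤ c) : α.edge w a c = α.edge w a b ≪≫ α.edge w b c := by
  obtain ⟨h, e⟩ := H.sliceProd_append w.1 w.2.1 hab hbc
  rw [edge, e, α.aut_prod]
  rfl

theorem edge_map {n m : SimplexCategoryᵒᵖ} (f : n ⟶ m) (w : H.toSSet.obj n)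
    {a b : Fin (m.unop.len + 1)} (hab : a ≤ b) :
    α.edge (H.toSSet.map f w) a b =
      α.edge w (f.unop.toOrderHom a) (f.unop.toOrderHom b) :=
  congrArg α.aut (H.sliceProd_pull w.1 w.2.1 f.unop.toOrderHom hab)

/-- This cocycle identity is what makes the twisted product functorial and its trivializations
natural. -/
theorem edge_comp_apply {n m k : SimplexCategoryᵒᵖ} (f : n ⟶ m) (g : m ⟶ k) (w : H.toSSet.obj n)
    (x : F.obj m) :
    (α.edge w 0 (f.unop.toOrderHom (g.unop.toOrderHom 0))).hom.app k (F.map g x) =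
      (α.edge (H.toSSet.map f w) 0 (g.unop.toOrderHom 0)).hom.app k
        (F.map g ((α.edge w 0 (f.unop.toOrderHom 0)).hom.app m x)) := by
  have h := α.edge_map f w (Fin.zero_le (g.unop.toOrderHom 0))
  rw [Fin.val_zero] at h
  rw [h, α.edge_trans w (Nat.zero_le (f.unop.toOrderHom 0 : ℕ))
    (f.unop.toOrderHom.monotone (Fin.zero_le (g.unop.toOrderHom 0)))]
  simp [← NatTrans.naturality_apply]

/-- The total space of the twisted product of `H` with fibre `F`. -/
def total : SSet.{u} where
  obj n := F.obj n × H.toSSet.obj n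
  -- The first component is a coordinate in the fibre over the initial vertex. An operator that
  -- moves the initial vertex from `0` to `f 0` has to transport it along that edge.
  map f := ↾fun p =>
    ((α.edge p.2 0 (f.unop.toOrderHom 0)).hom.app _ (F.map f p.1), H.toSSet.map f p.2)
  map_id n := by
    apply ConcreteCategory.hom_ext
    intro p
    refine Prod.ext ?_ ?_
    · change (α.edge p.2 0 0).hom.app _ (F.map (𝟙 _) p.1) = p.1
      simp [edge_self]
    · change H.toSSet.map (𝟙 _) p.2 = p.2
      simp
  map_comp {n m k} f g := by
    apply ConcreteCategory.hom_ext
    intro p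
    refine Prod.ext ?_ ?_
    · change (α.edge p.2 0 (f.unop.toOrderHom (g.unop.toOrderHom 0))).hom.app _
          (F.map (f ≫ g) p.1) = (α.edge (H.toSSet.map f p.2) 0 (g.unop.toOrderHom 0)).hom.app _
          (F.map g ((α.edge p.2 0 (f.unop.toOrderHom 0)).hom.app _ (F.map f p.1)))
      rw [← α.edge_comp_apply, Functor.map_comp_apply]
    · change H.toSSet.map (f ≫ g) p.2 = H.toSSet.map g (H.toSSet.map f p.2)
      simp

end Monodromy

/-! ### Pullbacks and rigidity of simplicial sets -/

namespace SSet

theorem congr_app {X Y : SSet.{u}} {f g : X ⟶ Y} (h : f = g) (k : SimplexCategoryᵒᵖ)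
    (x : X.obj k) : f.app k x = g.app k x := by rw [h]

theorem naturality_tensor {F K E : SSet.{u}} (φ : F ⊗ K ⟶ E) {k l : SimplexCategoryᵒᵖ}
    (f : k ⟶ l) (m : F.obj k) (y : K.obj k) :
    φ.app l (F.map f m, K.map f y) = E.map f (φ.app k (m, y)) :=
  NatTrans.naturality_apply φ f ((m, y) : F.obj k × K.obj k)

theorem isPullback_iff_forall {P X Y Z : SSet.{u}} {t : P ⟶ X} {l : P ⟶ Y} {r : X ⟶ Z}
    {b : Y ⟶ Z} :
    IsPullback t l r b ↔ t ≫ r = l ≫ b ∧ ∀ (k : SimplexCategoryᵒᵖ) (x : X.obj k) (y : Y.obj k),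
      r.app k x = b.app k y → ∃! p : P.obj k, t.app k p = x ∧ l.app k p = y := by
  rw [IsPullback.iff_app]
  simp only [Limits.Types.isPullback_iff]
  constructor
  · intro h
    refine ⟨?_, fun k x y hxy => ?_⟩
    · apply NatTrans.ext
      funext k
      exact (h k).1
    · obtain ⟨p, h1, h2⟩ := (h k).2.2 x y hxy
      exact ⟨p, ⟨h1, h2⟩, fun q hq => (h k).2.1 q p ⟨hq.1.trans h1.symm, hq.2.trans h2.symm⟩⟩
  · rintro ⟨h0, h⟩ k
    refine ⟨congr_arg (fun f => f.app k) h0, fun p q hpq => ?_, fun x y hxy => (h k x y hxy).exists⟩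
    have e : r.app k (t.app k q) = b.app k (l.app k q) :=
      SSet.congr_app h0 k q
    exact (h k _ _ e).unique hpq ⟨rfl, rfl⟩

/-- The inclusion of `F` into `F × Δ[n]` as the fibre over the vertex `i`. -/
def vertexInclusion (F : SSet.{u}) (n : ℕ) (i : Fin (n + 1)) : F ⟶ F ⊗ Δ[n] :=
  lift (𝟙 F) (SSet.const (stdSimplex.obj₀Equiv.symm i))

theorem vertexInclusion_fst (F : SSet.{u}) (n : ℕ) (i : Fin (n + 1)) :
    vertexInclusion F n i ≫ fst F Δ[n] = 𝟙 F := lift_fst _ _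

theorem vertexInclusion_snd (F : SSet.{u}) (n : ℕ) (i : Fin (n + 1)) :
    vertexInclusion F n i ≫ snd F Δ[n] = SSet.const (stdSimplex.obj₀Equiv.symm i) := lift_snd _ _

theorem vertexInclusion_whiskerRight {F F' : SSet.{u}} (g : F ⟶ F') (n : ℕ) (i : Fin (n + 1)) :
    vertexInclusion F n i ≫ (g ▷ Δ[n]) = g ≫ vertexInclusion F' n i := rfl

theorem vertexInclusion_whiskerLeft (F : SSet.{u}) {m n : ℕ} (f : ⦋m⦌ ⟶ ⦋n⦌) (i : Fin (m + 1)) :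
    vertexInclusion F m i ≫ (F ◁ SSet.stdSimplex.map f) = vertexInclusion F n (f.toOrderHom i) := rfl

/-- A simplicial set is rigid if every family of self-maps parametrized by a simplex that is
invertible at the vertices is constant. -/
def Rigid (F : SSet.{u}) : Prop :=
  ∀ (n : ℕ) (Φ : F ⊗ Δ[n] ⟶ F), (∀ i, IsIso (vertexInclusion F n i ≫ Φ)) →
    Φ = fst F Δ[n] ≫ vertexInclusion F n 0 ≫ Φ

end SSet

open SSet

namespace PartialGroup

theorem toSSet_eq_const {A : Type u} (H : PartialGroup A) (x : H.toSSet _⦋0⦌) : x = H.vertex :=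
  Subtype.ext (List.length_eq_zero_iff.1 x.2.2)

/-- There is only one vertex in the base, so the fibre over any vertex of a simplex can be compared
with the fibre given by `ι`. -/
theorem map_const {A : Type u} (H : PartialGroup A) {n : ℕ} (b : H.toSSet _⦋n⦌) (i : Fin (n + 1))
    (k : SimplexCategoryᵒᵖ) (y : (Δ[0] : SSet.{u}).obj k) :
    (SSet.yonedaEquiv.symm b).app k (stdSimplex.const n i k) = (SSet.yonedaEquiv.symm H.vertex).app k y := by
  have e : (SSet.yonedaEquiv.symm b).app k (stdSimplex.const n i k) = H.toSSet.map
      (SimplexCategory.const k.unop ⦋0⦌ 0).op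
        (H.toSSet.map (SimplexCategory.const ⦋0⦌ ⦋n⦌ i).op b) := by
    rw [← Functor.map_comp_apply]; rfl
  rw [e, H.toSSet_eq_const (H.toSSet.map (SimplexCategory.const ⦋0⦌ ⦋n⦌ i).op b)]
  have e2 : y = stdSimplex.objEquiv.symm (SimplexCategory.const k.unop ⦋0⦌ 0) :=
    stdSimplex.objEquiv.injective (Subsingleton.elim _ _)
  rw [e2]
  rfl

end PartialGroup

/-! ### Normalized trivializations and transport -/

namespace PartialGroupExtension

variable {A B : Type u} {H : PartialGroup A} {M : PartialGroup B} (e : PartialGroupExtension H M)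

/-- A trivialization of an extension over a simplex. -/
def IsTrivialization {n : ℕ} (b : H.toSSet _⦋n⦌) (φ : M.toSSet ⊗ Δ[n] ⟶ e.E) : Prop :=
  IsPullback φ (snd M.toSSet Δ[n]) e.τ (SSet.yonedaEquiv.symm b)

/-- A trivialization that restricts to the given identification of the fibre over the initial
vertex. -/
structure IsNormalized {n : ℕ} (b : H.toSSet _⦋n⦌) (φ : M.toSSet ⊗ Δ[n] ⟶ e.E) : Prop where
  isTrivialization : e.IsTrivialization b φ
  initial : vertexInclusion M.toSSet n 0 ≫ φ = e.ι

variable {e}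

theorem IsTrivialization.existsUnique {n : ℕ} {b : H.toSSet _⦋n⦌} {φ : M.toSSet ⊗ Δ[n] ⟶ e.E}
    (h : e.IsTrivialization b φ) {k : SimplexCategoryᵒᵖ} (x : e.E.obj k)
    (y : (Δ[n] : SSet.{u}).obj k)
    (hxy : e.τ.app k x = (SSet.yonedaEquiv.symm b).app k y) :
    ∃! m : M.toSSet.obj k, φ.app k (m, y) = x := by
  obtain ⟨⟨m, y'⟩, ⟨h1, h2⟩, h3⟩ := (isPullback_iff_forall.1 h).2 k x y hxy
  obtain rfl : y' = y := h2
  exact ⟨m, h1, fun m' hm' => congrArg Prod.fst (h3 (m', y') ⟨hm', rfl⟩)⟩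

theorem IsTrivialization.app_τ {n : ℕ} {b : H.toSSet _⦋n⦌} {φ : M.toSSet ⊗ Δ[n] ⟶ e.E}
    (h : e.IsTrivialization b φ) {k : SimplexCategoryᵒᵖ} (m : M.toSSet.obj k)
    (y : (Δ[n] : SSet.{u}).obj k) :
    e.τ.app k (φ.app k (m, y)) = (SSet.yonedaEquiv.symm b).app k y :=
  SSet.congr_app h.w k (m, y)

theorem isTrivialization_of_existsUnique {n : ℕ} {b : H.toSSet _⦋n⦌} {φ : M.toSSet ⊗ Δ[n] ⟶ e.E}
    (h1 : ∀ k m y, e.τ.app k (φ.app k (m, y)) = (SSet.yonedaEquiv.symm b).app k y)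
    (h2 : ∀ k x y, e.τ.app k x = (SSet.yonedaEquiv.symm b).app k y →
      ∃! m : M.toSSet.obj k, φ.app k (m, y) = x) :
    e.IsTrivialization b φ := by
  refine isPullback_iff_forall.2 ⟨?_, fun k x y hxy => ?_⟩
  · ext k ⟨m, y⟩
    exact h1 k m y
  · obtain ⟨m, hm, hu⟩ := h2 k x y hxy
    refine ⟨(m, y), ⟨hm, rfl⟩, ?_⟩
    rintro ⟨m', y'⟩ ⟨h3, h4⟩
    obtain rfl : y' = y := h4
    rw [hu m' h3]

/-- The restriction of a trivialization to a vertex and the inclusion `ι` are both pullbacks of `τ`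
along the unique vertex of the base, hence differ by an automorphism of the fibre. -/
theorem IsTrivialization.exists_vertex {n : ℕ} {b : H.toSSet _⦋n⦌} {φ : M.toSSet ⊗ Δ[n] ⟶ e.E}
    (h : e.IsTrivialization b φ) (i : Fin (n + 1)) :
    ∃ g : M.toSSet ≅ M.toSSet, g.hom ≫ e.ι = vertexInclusion M.toSSet n i ≫ φ := by
  have key : IsPullback (vertexInclusion M.toSSet n i ≫ φ)
      (SSet.stdSimplex.isTerminalObj₀.from M.toSSet) e.τ
      (SSet.yonedaEquiv.symm H.vertex : Δ[0] ⟶ H.toSSet) := by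
    refine isPullback_iff_forall.2 ⟨?_, fun k x y hxy => ?_⟩
    · ext k m
      exact (h.app_τ m (stdSimplex.const n i k)).trans (H.map_const b i k _)
    · obtain ⟨m, hm, hu⟩ := h.existsUnique x (stdSimplex.const n i k)
        (hxy.trans (H.map_const b i k y).symm)
      exact ⟨m, ⟨hm, stdSimplex.objEquiv.injective (Subsingleton.elim _ _)⟩,
        fun m' hm' => hu m' hm'.1⟩
  exact ⟨key.isoIsPullback _ _ e.isPullback, key.isoIsPullback_hom_fst _ _ e.isPullback⟩

theorem ι_injective (k : SimplexCategoryᵒᵖ) : Function.Injective (e.ι.app k) := by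
  intro x y hxy
  have hw := SSet.congr_app e.isPullback.w k x
  exact ((isPullback_iff_forall.1 e.isPullback).2 k _ _ hw).unique ⟨rfl, rfl⟩
    ⟨hxy.symm, stdSimplex.objEquiv.injective (Subsingleton.elim _ _)⟩

theorem ι_cancel {Z : SSet.{u}} {f g : Z ⟶ M.toSSet} (h : f ≫ e.ι = g ≫ e.ι) : f = g := by
  ext k z
  exact ι_injective k (SSet.congr_app h k z)

theorem IsTrivialization.whiskerRight {n : ℕ} {b : H.toSSet _⦋n⦌} {φ : M.toSSet ⊗ Δ[n] ⟶ e.E}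
    (h : e.IsTrivialization b φ) (g : M.toSSet ≅ M.toSSet) :
    e.IsTrivialization b ((g.hom ▷ Δ[n]) ≫ φ) := by
  refine isTrivialization_of_existsUnique (fun k m y => h.app_τ _ y) fun k x y hxy => ?_
  obtain ⟨m, hm, hu⟩ := h.existsUnique x y hxy
  refine ⟨g.inv.app k m, ?_, fun m' hm' => ?_⟩
  · change φ.app k (g.hom.app k (g.inv.app k m), y) = x
    rw [← hm]; simp
  · have h3 : g.hom.app k m' = m := hu _ hm'
    rw [← h3]; simp

theorem IsTrivialization.whiskerLeft {m n : ℕ} {b : H.toSSet _⦋n⦌} {φ : M.toSSet ⊗ Δ[n] ⟶ e.E}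
    (h : e.IsTrivialization b φ) (f : ⦋m⦌ ⟶ ⦋n⦌) :
    e.IsTrivialization (H.toSSet.map f.op b) ((M.toSSet ◁ SSet.stdSimplex.map f) ≫ φ) := by
  have key : ∀ (k : SimplexCategoryᵒᵖ) (y : (Δ[m] : SSet.{u}).obj k),
      (SSet.yonedaEquiv.symm (H.toSSet.map f.op b)).app k y =
        (SSet.yonedaEquiv.symm b).app k ((SSet.stdSimplex.map f).app k y) := by
    intro k y
    change H.toSSet.map (stdSimplex.objEquiv y).op (H.toSSet.map f.op b) = _
    rw [← Functor.map_comp_apply]; rfl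
  refine isTrivialization_of_existsUnique
    (fun k x y => (h.app_τ x _).trans (key k y).symm) fun k x y hxy => ?_
  exact h.existsUnique x ((SSet.stdSimplex.map f).app k y) (hxy.trans (key k y))

theorem exists_isNormalized (e : PartialGroupExtension H M) {n : ℕ} (b : H.toSSet _⦋n⦌) :
    ∃ φ : M.toSSet ⊗ Δ[n] ⟶ e.E, e.IsNormalized b φ := by
  obtain ⟨φ, hφ⟩ := e.isFibreBundle.locallyTrivial n (SSet.yonedaEquiv.symm b)
  obtain ⟨g, hg⟩ := IsTrivialization.exists_vertex (e := e) hφ 0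
  refine ⟨(g.inv ▷ Δ[n]) ≫ φ, IsTrivialization.whiskerRight (e := e) hφ g.symm, ?_⟩
  rw [← Category.assoc, vertexInclusion_whiskerRight, Category.assoc, ← hg, Iso.inv_hom_id_assoc]

/-- The two trivializations differ by a self-map of the product over the simplex, that is, by a
family of self-maps of the fibre. Rigidity makes the family constant, and its value at the initial
vertex is `g`. -/
theorem IsTrivialization.eq_whiskerRight (hM : M.toSSet.Rigid) {n : ℕ} {b : H.toSSet _⦋n⦌}
    {φ φ' : M.toSSet ⊗ Δ[n] ⟶ e.E} (h : e.IsTrivialization b φ) (h' : e.IsNormalized b φ')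
    (g : M.toSSet ≅ M.toSSet) (hg : g.hom ≫ e.ι = vertexInclusion M.toSSet n 0 ≫ φ) :
    φ = (g.hom ▷ Δ[n]) ≫ φ' := by
  have h1 := h'.isTrivialization
  let Φ : M.toSSet ⊗ Δ[n] ⟶ M.toSSet ⊗ Δ[n] := IsPullback.lift h1 φ (snd _ _) h.w
  have hΦ1 : Φ ≫ φ' = φ := IsPullback.lift_fst _ _ _ _
  have hΦ2 : Φ ≫ snd _ _ = snd _ _ := IsPullback.lift_snd _ _ _ _
  have hv : ∀ i, vertexInclusion M.toSSet n i ≫ Φ =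
      (vertexInclusion M.toSSet n i ≫ Φ ≫ fst _ _) ≫ vertexInclusion M.toSSet n i := by
    intro i
    apply CartesianMonoidalCategory.hom_ext
    · simp [vertexInclusion_fst]
    · rw [Category.assoc, hΦ2, Category.assoc, vertexInclusion_snd]
      rfl
  have hvφ : ∀ i, vertexInclusion M.toSSet n i ≫ φ =
      (vertexInclusion M.toSSet n i ≫ Φ ≫ fst _ _) ≫ vertexInclusion M.toSSet n i ≫ φ' := by
    intro i
    rw [← Category.assoc _ _ φ', ← hv, Category.assoc, hΦ1]
  -- At a vertex both trivializations are an automorphism followed by the monomorphism `ι`, so their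
  -- difference is invertible there.
  have hiso : ∀ i, IsIso (vertexInclusion M.toSSet n i ≫ Φ ≫ fst _ _) := by
    intro i
    obtain ⟨p, hp⟩ := h.exists_vertex i
    obtain ⟨q, hq⟩ := h1.exists_vertex i
    have : vertexInclusion M.toSSet n i ≫ Φ ≫ fst _ _ = p.hom ≫ q.inv := by
      rw [Iso.eq_comp_inv]
      apply ι_cancel (e := e)
      rw [Category.assoc, hq, ← hvφ, hp]
    rw [this]
    infer_instance
  have hfst := hM n (Φ ≫ fst _ _) hiso
  have h0 : vertexInclusion M.toSSet n 0 ≫ Φ ≫ fst _ _ = g.hom := by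
    apply ι_cancel (e := e)
    rw [hg, hvφ, h'.initial]
  have hΦ : Φ = g.hom ▷ Δ[n] := by
    apply CartesianMonoidalCategory.hom_ext
    · rw [hfst, h0]; simp
    · rw [hΦ2]; simp
  rw [← hΦ1, hΦ]

theorem IsNormalized.unique (hM : M.toSSet.Rigid) {n : ℕ} {b : H.toSSet _⦋n⦌}
    {φ φ' : M.toSSet ⊗ Δ[n] ⟶ e.E} (h : e.IsNormalized b φ) (h' : e.IsNormalized b φ') :
    φ = φ' := by
  have := h.isTrivialization.eq_whiskerRight hM h' (Iso.refl _) (by simp [h.initial])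
  simpa using this

/-- The normalized trivialization over a simplex. -/
noncomputable def triv (e : PartialGroupExtension H M) {n : ℕ} (b : H.toSSet _⦋n⦌) :
    M.toSSet ⊗ Δ[n] ⟶ e.E :=
  (e.exists_isNormalized b).choose

theorem isNormalized_triv (e : PartialGroupExtension H M) {n : ℕ} (b : H.toSSet _⦋n⦌) :
    e.IsNormalized b (e.triv b) :=
  (e.exists_isNormalized b).choose_spec

/-- The transport from the initial vertex of a simplex to another vertex. -/
noncomputable def transport (e : PartialGroupExtension H M) {n : ℕ} (b : H.toSSet _⦋n⦌)
    (i : Fin (n + 1)) : M.toSSet ≅ M.toSSet :=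
  ((e.isNormalized_triv b).isTrivialization.exists_vertex i).choose

theorem transport_ι (e : PartialGroupExtension H M) {n : ℕ} (b : H.toSSet _⦋n⦌)
    (i : Fin (n + 1)) :
    (e.transport b i).hom ≫ e.ι = vertexInclusion M.toSSet n i ≫ e.triv b :=
  ((e.isNormalized_triv b).isTrivialization.exists_vertex i).choose_spec

theorem transport_zero (e : PartialGroupExtension H M) {n : ℕ} (b : H.toSSet _⦋n⦌) :
    e.transport b 0 = Iso.refl _ := by
  ext1
  apply ι_cancel (e := e)
  rw [transport_ι, (e.isNormalized_triv b).initial]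
  simp

/-- A restricted trivialization is again a trivialization, but it is normalized only up to the
transport to its new initial vertex. -/
theorem triv_map (hM : M.toSSet.Rigid) (e : PartialGroupExtension H M) {m n : ℕ}
    (b : H.toSSet _⦋n⦌) (f : ⦋m⦌ ⟶ ⦋n⦌) :
    (M.toSSet ◁ SSet.stdSimplex.map f) ≫ e.triv b =
      ((e.transport b (f.toOrderHom 0)).hom ▷ Δ[m]) ≫ e.triv (H.toSSet.map f.op b) := by
  refine ((e.isNormalized_triv b).isTrivialization.whiskerLeft f).eq_whiskerRight hM
    (e.isNormalized_triv _) _ ?_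
  rw [transport_ι, ← Category.assoc, vertexInclusion_whiskerLeft]

theorem transport_map (hM : M.toSSet.Rigid) (e : PartialGroupExtension H M) {m n : ℕ}
    (b : H.toSSet _⦋n⦌) (f : ⦋m⦌ ⟶ ⦋n⦌) (i : Fin (m + 1)) :
    e.transport b (f.toOrderHom i) =
      e.transport b (f.toOrderHom 0) ≪≫ e.transport (H.toSSet.map f.op b) i := by
  ext1
  apply ι_cancel (e := e)
  rw [transport_ι, ← vertexInclusion_whiskerLeft, Category.assoc, e.triv_map hM, Iso.trans_hom,
    Category.assoc, transport_ι, ← Category.assoc, vertexInclusion_whiskerRight, Category.assoc]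

end PartialGroupExtension

/-! ### The extension attached to a representation -/

namespace Monodromy

variable {A B : Type u} {H : PartialGroup A} {M : PartialGroup B} (α : Monodromy H M.toSSet)

/-- The projection of the twisted product to the base. -/
def proj : α.total ⟶ H.toSSet where
  app _ := ↾Prod.snd
  naturality _ _ _ := rfl

theorem edge_vertex {n : SimplexCategoryᵒᵖ} (f : Opposite.op ⦋0⦌ ⟶ n) (a : Fin (n.unop.len + 1)) :
    α.edge (H.toSSet.map f H.vertex) 0 a = Iso.refl _ := by
  have h := α.edge_map f H.vertex (Fin.zero_le a)
  rw [Fin.val_zero] at h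
  rw [h, Subsingleton.elim (α := Fin 1) (f.unop.toOrderHom a) (f.unop.toOrderHom 0), edge_self]

/-- The inclusion of the fibre of the twisted product over the vertex. -/
def incl : M.toSSet ⟶ α.total where
  app k := ↾fun m => (m, H.toSSet.map (SimplexCategory.const k.unop ⦋0⦌ 0).op H.vertex)
  naturality k l f := by
    apply ConcreteCategory.hom_ext
    intro m
    refine Prod.ext ?_ ?_
    · change M.toSSet.map f m = (α.edge (H.toSSet.map _ H.vertex) 0 _).hom.app _ (M.toSSet.map f m)
      rw [α.edge_vertex]
      simp
    · change H.toSSet.map _ H.vertex = H.toSSet.map f (H.toSSet.map _ H.vertex)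
      rw [← Functor.map_comp_apply]
      rfl

/-- The trivialization of the twisted product over a simplex. -/
def trivialization {n : ℕ} (b : H.toSSet _⦋n⦌) : M.toSSet ⊗ Δ[n] ⟶ α.total where
  app k := ↾fun p => ((α.edge b 0 ((stdSimplex.objEquiv p.2).toOrderHom 0)).hom.app k p.1,
    (SSet.yonedaEquiv.symm b).app k p.2)
  naturality k l f := by
    apply ConcreteCategory.hom_ext
    rintro ⟨m, y⟩
    refine Prod.ext ?_ ?_
    · exact α.edge_comp_apply (stdSimplex.objEquiv y).op f b m
    · exact ConcreteCategory.congr_hom ((SSet.yonedaEquiv.symm b).naturality f) y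

theorem trivialization_existsUnique {n : ℕ} (b : H.toSSet _⦋n⦌) (k : SimplexCategoryᵒᵖ)
    (x : α.total.obj k) (y : (Δ[n] : SSet.{u}).obj k)
    (hxy : α.proj.app k x = (SSet.yonedaEquiv.symm b).app k y) :
    ∃! m : M.toSSet.obj k, (α.trivialization b).app k (m, y) = x := by
  refine ⟨(α.edge b 0 ((stdSimplex.objEquiv y).toOrderHom 0)).inv.app k x.1, ?_, fun m hm => ?_⟩
  · refine Prod.ext ?_ hxy.symm
    change (α.edge b 0 ((stdSimplex.objEquiv y).toOrderHom 0)).hom.app k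
      ((α.edge b 0 ((stdSimplex.objEquiv y).toOrderHom 0)).inv.app k x.1) = x.1
    simp
  · have h : (α.edge b 0 ((stdSimplex.objEquiv y).toOrderHom 0)).hom.app k m = x.1 :=
      congrArg Prod.fst hm
    rw [← h]
    simp

/-- The extension defined by a representation of the base on the fibre. -/
def extension : PartialGroupExtension H M where
  E := α.total
  ι := α.incl
  τ := α.proj
  isFibreBundle :=
    { surjective := fun n b => by
        obtain ⟨n⟩ := n
        exact ⟨(M.toSSet.map (SimplexCategory.const n ⦋0⦌ 0).op M.vertex, b), rfl⟩
      locallyTrivial := fun n b => by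
        obtain ⟨b, rfl⟩ := SSet.yonedaEquiv.symm.surjective b
        refine ⟨α.trivialization b, isPullback_iff_forall.2 ⟨rfl, fun k x y hxy => ?_⟩⟩
        obtain ⟨m, hm, hu⟩ := α.trivialization_existsUnique b k x y hxy
        refine ⟨(m, y), ⟨hm, rfl⟩, ?_⟩
        rintro ⟨m', y'⟩ ⟨h3, h4⟩
        obtain rfl : y' = y := h4
        rw [hu m' h3] }
  isPullback := by
    have key : ∀ (k : SimplexCategoryᵒᵖ) (y : (Δ[0] : SSet.{u}).obj k),
        H.toSSet.map (SimplexCategory.const k.unop ⦋0⦌ 0).op H.vertex =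
          (SSet.yonedaEquiv.symm H.vertex).app k y := by
      intro k y
      rw [show y = stdSimplex.objEquiv.symm (SimplexCategory.const k.unop ⦋0⦌ 0) from
        stdSimplex.objEquiv.injective (Subsingleton.elim _ _)]
      rfl
    refine isPullback_iff_forall.2 ⟨?_, fun k x y hxy => ?_⟩
    · ext k m
      exact key k _
    · refine ⟨x.1, ⟨Prod.ext rfl ((key k y).trans hxy.symm),
        stdSimplex.objEquiv.injective (Subsingleton.elim _ _)⟩, fun m hm => ?_⟩
      exact congrArg Prod.fst hm.1

/-- Evaluated on edges, this says that the twisted product has monodromy `α`. -/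
theorem vertexInclusion_trivialization {n : ℕ} (b : H.toSSet _⦋n⦌) (i : Fin (n + 1)) :
    vertexInclusion M.toSSet n i ≫ α.trivialization b = (α.edge b 0 i).hom ≫ α.incl := by
  ext k m
  refine Prod.ext rfl ?_
  exact H.map_const b i k (stdSimplex.objEquiv.symm (SimplexCategory.const k.unop ⦋0⦌ 0))

theorem isNormalized_trivialization {n : ℕ} (b : H.toSSet _⦋n⦌) :
    α.extension.IsNormalized b (α.trivialization b) where
  isTrivialization := PartialGroupExtension.isTrivialization_of_existsUnique
    (fun _ _ _ => rfl) (α.trivialization_existsUnique b)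
  initial := by
    have h := α.vertexInclusion_trivialization b 0
    rw [Fin.val_zero, edge_self] at h
    exact h

end Monodromy

/-! ### Classification of extensions by monodromy -/

namespace PartialGroup

/-- The edge given by an element of a partial group. -/
def toEdge {A : Type u} (H : PartialGroup A) (x : A) : H.toSSet _⦋1⦌ :=
  ⟨[x], H.singleton_mem x, rfl⟩

theorem map_mkOfLe {A : Type u} (H : PartialGroup A) {n : ℕ} (b : H.toSSet _⦋n⦌)
    {i j : Fin (n + 1)} (hij : i ≤ j) :
    H.toSSet.map (SimplexCategory.mkOfLe i j hij).op b = H.toEdge (H.sliceProd b.1 b.2.1 i j) :=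
  Subtype.ext rfl

theorem sliceProd_toEdge {A : Type u} (H : PartialGroup A) (x : A) :
    H.sliceProd (H.toEdge x).1 (H.toEdge x).2.1 0 1 = x :=
  H.prod_singleton x

end PartialGroup

namespace PartialGroupExtension

variable {A B : Type u} {H : PartialGroup A} {M : PartialGroup B}

theorem isNormalized_comp {e e' : PartialGroupExtension H M} (ψ : e.E ≅ e'.E)
    (hι : e.ι ≫ ψ.hom = e'.ι) (hτ : ψ.hom ≫ e'.τ = e.τ) {n : ℕ} {b : H.toSSet _⦋n⦌}
    {φ : M.toSSet ⊗ Δ[n] ⟶ e.E} (h : e.IsNormalized b φ) : e'.IsNormalized b (φ ≫ ψ.hom) where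
  isTrivialization := IsPullback.of_iso h.isTrivialization (Iso.refl _) ψ (Iso.refl _) (Iso.refl _)
    (by simp) (by simp) (by simp [hτ]) (by simp)
  initial := by rw [← Category.assoc, h.initial, hι]

/-- Restriction to the edge from `i` to `j` reduces all transports to those along edges. -/
theorem transport_trans (hM : M.toSSet.Rigid) (e : PartialGroupExtension H M) {n : ℕ}
    (b : H.toSSet _⦋n⦌) {i j : Fin (n + 1)} (hij : i ≤ j) :
    e.transport b j = e.transport b i ≪≫ e.transport (H.toEdge (H.sliceProd b.1 b.2.1 i j)) 1 := by
  have h := e.transport_map hM b (SimplexCategory.mkOfLe i j hij) 1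
  rw [H.map_mkOfLe] at h
  exact h

/-- The representation of the base on the fibre by transport along edges. -/
noncomputable def monodromy (hM : M.toSSet.Rigid) (e : PartialGroupExtension H M) :
    Monodromy H M.toSSet where
  aut x := e.transport (H.toEdge x) 1
  aut_prod x y h := by
    -- The edges of this triangle are `x`, `y` and their product. Transport to its last vertex is
    -- computed both directly and through the middle vertex.
    let b : H.toSSet _⦋2⦌ := ⟨[x, y], h, rfl⟩
    have h1 := e.transport_trans hM b (show (0 : Fin 3) ≤ 1 by decide)
    have h2 := e.transport_trans hM b (show (1 : Fin 3) ≤ 2 by decide)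
    have h3 := e.transport_trans hM b (show (0 : Fin 3) ≤ 2 by decide)
    rw [transport_zero, Iso.refl_trans,
      show H.sliceProd b.1 b.2.1 (0 : Fin 3) (1 : Fin 3) = x from H.prod_singleton x] at h1
    rw [show H.sliceProd b.1 b.2.1 (1 : Fin 3) (2 : Fin 3) = y from H.prod_singleton y, h1] at h2
    rw [transport_zero, Iso.refl_trans] at h3
    exact h3.symm.trans h2

theorem transport_eq_edge (hM : M.toSSet.Rigid) (e : PartialGroupExtension H M) {n : ℕ}
    (b : H.toSSet _⦋n⦌) (i : Fin (n + 1)) : e.transport b i = (e.monodromy hM).edge b 0 i := by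
  rw [e.transport_trans hM b (Fin.zero_le i), transport_zero, Iso.refl_trans]
  rfl

/-- The comparison of the twisted product with a given extension. -/
noncomputable def comparison (hM : M.toSSet.Rigid) (e : PartialGroupExtension H M) :
    (e.monodromy hM).total ⟶ e.E where
  -- The identity simplex of $\Delta[k]$ lies over `p.2` itself.
  app k := ↾fun p => (e.triv (n := k.unop.len) p.2).app k (p.1, stdSimplex.objEquiv.symm (𝟙 _))
  naturality k l f := by
    apply ConcreteCategory.hom_ext
    rintro ⟨m, w⟩
    change (e.triv (n := l.unop.len) (H.toSSet.map f w)).app l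
        (((e.monodromy hM).edge w 0 (f.unop.toOrderHom 0)).hom.app _ (M.toSSet.map f m),
          stdSimplex.objEquiv.symm (𝟙 _)) =
      e.E.map f ((e.triv (n := k.unop.len) w).app k (m, stdSimplex.objEquiv.symm (𝟙 _)))
    have h1 := SSet.congr_app (e.triv_map hM (n := k.unop.len) (m := l.unop.len) w f.unop) l
      (M.toSSet.map f m, stdSimplex.objEquiv.symm (𝟙 _))
    rw [e.transport_eq_edge hM] at h1
    refine h1.symm.trans ?_
    exact naturality_tensor (e.triv (n := k.unop.len) w) f m (stdSimplex.objEquiv.symm (𝟙 k.unop))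

/-- The map preserves the projection to the base, and over a fixed simplex `w` it is the bijection
from the simplices of the fibre to those over `w` given by the trivialization. -/
theorem comparison_bijective (hM : M.toSSet.Rigid) (e : PartialGroupExtension H M)
    (k : SimplexCategoryᵒᵖ) : Function.Bijective ((e.comparison hM).app k) := by
  have key : ∀ w : H.toSSet.obj k, (SSet.yonedaEquiv.symm (w : H.toSSet _⦋k.unop.len⦌)).app k
      (stdSimplex.objEquiv.symm (𝟙 _)) = w := fun w =>
    ConcreteCategory.congr_hom (H.toSSet.map_id k) w
  have hτ : ∀ p, e.τ.app k ((e.comparison hM).app k p) = p.2 := fun p =>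
    ((e.isNormalized_triv (n := k.unop.len) p.2).isTrivialization.app_τ _ _).trans (key p.2)
  refine ⟨?_, fun x => ?_⟩
  · rintro ⟨m, w⟩ ⟨m', w'⟩ h
    have hw : w = w' := (hτ (m, w)).symm.trans ((congrArg (e.τ.app k) h).trans (hτ (m', w')))
    subst hw
    obtain ⟨m₀, _, hu⟩ := (e.isNormalized_triv (n := k.unop.len) w).isTrivialization.existsUnique
      _ _ ((hτ (m, w)).trans (key w).symm)
    exact Prod.ext ((hu m rfl).trans (hu m' h.symm).symm) rfl
  · obtain ⟨m, hm, _⟩ := (e.isNormalized_triv (n := k.unop.len)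
      (e.τ.app k x)).isTrivialization.existsUnique x _ (key (e.τ.app k x)).symm
    exact ⟨(m, e.τ.app k x), hm⟩

theorem monodromy_extension_equiv (hM : M.toSSet.Rigid) (e : PartialGroupExtension H M) :
    (setoid H M).r (e.monodromy hM).extension e := by
  have : IsIso (e.comparison hM) := by
    rw [NatTrans.isIso_iff_isIso_app]
    intro k
    rw [isIso_iff_bijective]
    exact e.comparison_bijective hM k
  refine ⟨(asIso (e.comparison hM) : (e.monodromy hM).total ≅ e.E), ?_, ?_⟩
  · ext k m
    -- Over a degenerate simplex on the vertex, the normalized trivialization factors through the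
    -- one over the vertex, which is `ι`.
    have h1 := SSet.congr_app (e.triv_map hM H.vertex (SimplexCategory.const k.unop ⦋0⦌ 0)) k
      (m, stdSimplex.objEquiv.symm (𝟙 _))
    rw [show (SimplexCategory.const k.unop ⦋0⦌ 0).toOrderHom 0 = 0 from rfl, transport_zero] at h1
    have h2 := SSet.congr_app (e.isNormalized_triv H.vertex).initial k m
    refine h1.symm.trans (Eq.trans ?_ h2)
    refine congrArg ((e.triv H.vertex).app k) (Prod.ext rfl ?_)
    exact stdSimplex.objEquiv.injective (Subsingleton.elim _ _)
  · ext k p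
    exact ((e.isNormalized_triv (n := k.unop.len) p.2).isTrivialization.app_τ _ _).trans
      (ConcreteCategory.congr_hom (H.toSSet.map_id k) p.2)

/-- An equivalence carries normalized trivializations to normalized ones. By uniqueness they match
over the edge `x`, and their values at its end vertex are `α.aut x` and `β.aut x`, each followed by
the same monomorphism. -/
theorem monodromy_eq_of_extension_equiv (hM : M.toSSet.Rigid) {α β : Monodromy H M.toSSet}
    (h : (setoid H M).r α.extension β.extension) : α = β := by
  obtain ⟨ψ, hι, hτ⟩ := h
  ext1
  funext x
  have h1 := (isNormalized_comp ψ hι hτ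
    (α.isNormalized_trivialization (H.toEdge x))).unique hM
      (β.isNormalized_trivialization (H.toEdge x))
  have h2 := congrArg (fun φ => vertexInclusion M.toSSet 1 1 ≫ φ) h1
  have e1 := α.vertexInclusion_trivialization (H.toEdge x) 1
  have e2 := β.vertexInclusion_trivialization (H.toEdge x) 1
  have h3 : (α.edge (H.toEdge x) 0 1).hom ≫ β.extension.ι =
      (β.edge (H.toEdge x) 0 1).hom ≫ β.extension.ι := by
    rw [← hι]
    refine Eq.trans ?_ (Eq.trans h2 ?_)
    · exact (congrArg (fun φ => φ ≫ ψ.hom) e1).symm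
    · rw [hι]; exact e2
  have h4 := Iso.ext (ι_cancel h3)
  rw [Monodromy.edge, Monodromy.edge, H.sliceProd_toEdge] at h4
  exact h4

/-- Extensions with rigid fibre are classified by their monodromy. -/
noncomputable def classesEquiv (hM : M.toSSet.Rigid) :
    Monodromy H M.toSSet ≃ ExtensionClasses H M :=
  Equiv.ofBijective (fun α => Quotient.mk (setoid H M) α.extension)
    ⟨fun _ _ h => monodromy_eq_of_extension_equiv hM (Quotient.exact h), fun q => by
      obtain ⟨e, rfl⟩ := Quotient.exists_rep q
      exact ⟨e.monodromy hM, Quotient.sound (e.monodromy_extension_equiv hM)⟩⟩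

end PartialGroupExtension

/-! ### Partial groups in terms of edges and triangles -/

namespace PartialGroup

variable {A : Type u} (H : PartialGroup A)

theorem toEdge_bijective : Function.Bijective H.toEdge := by
  refine ⟨fun x y h => List.singleton_inj.1 (congrArg Subtype.val h), fun w => ?_⟩
  obtain ⟨x, hx⟩ := List.length_eq_one_iff.1 w.2.2
  exact ⟨x, Subtype.ext hx.symm⟩

theorem map_vertex : H.toSSet.map (SimplexCategory.const ⦋1⦌ ⦋0⦌ 0).op H.vertex =
    H.toEdge H.one :=
  Subtype.ext rfl

/-- This turns naturality of simplicial maps on triangles into multiplicative relations. -/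
theorem prod_eq_of_faces {w : H.toSSet _⦋2⦌} {x y z : A}
    (h01 : H.toSSet.map (SimplexCategory.mkOfLe 0 1 (by decide)).op w = H.toEdge x)
    (h12 : H.toSSet.map (SimplexCategory.mkOfLe 1 2 (by decide)).op w = H.toEdge y)
    (h02 : H.toSSet.map (SimplexCategory.mkOfLe 0 2 (by decide)).op w = H.toEdge z) :
    ∃ h : [x, y] ∈ H.dom, H.prod _ h = z := by
  rw [map_mkOfLe] at h01 h12 h02
  replace h01 := H.toEdge_bijective.1 h01
  replace h12 := H.toEdge_bijective.1 h12
  replace h02 := H.toEdge_bijective.1 h02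
  obtain ⟨h, e⟩ := H.sliceProd_append w.1 w.2.1 (show 0 ≤ 1 by decide) (show 1 ≤ 2 by decide)
  subst h01 h12 h02
  exact ⟨h, e.symm⟩

/-- The 2-simplex of a pair of composable elements. -/
def toTriangle {x y : A} (h : [x, y] ∈ H.dom) : H.toSSet _⦋2⦌ := ⟨[x, y], h, rfl⟩

theorem toTriangle_fst {x y : A} (h : [x, y] ∈ H.dom) :
    H.toSSet.map (SimplexCategory.mkOfLe 0 1 (by decide)).op (H.toTriangle h) = H.toEdge x := by
  rw [map_mkOfLe]
  exact congrArg H.toEdge (H.prod_singleton x)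

theorem toTriangle_snd {x y : A} (h : [x, y] ∈ H.dom) :
    H.toSSet.map (SimplexCategory.mkOfLe 1 2 (by decide)).op (H.toTriangle h) = H.toEdge y := by
  rw [map_mkOfLe]
  exact congrArg H.toEdge (H.prod_singleton y)

theorem toTriangle_prod {x y : A} (h : [x, y] ∈ H.dom) :
    H.toSSet.map (SimplexCategory.mkOfLe 0 2 (by decide)).op (H.toTriangle h) =
      H.toEdge (H.prod _ h) := by
  rw [map_mkOfLe]
  rfl

theorem sliceProd_succ (w : List A) (hw : w ∈ H.dom) (i : ℕ) (hi : i < w.length) :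
    H.sliceProd w hw i (i + 1) = w[i] := by
  have e : slice w i (i + 1) = [w[i]] := by
    rw [slice, List.drop_take, List.drop_eq_getElem_cons hi, Nat.add_sub_cancel_left]
    rfl
  rw [sliceProd, H.prod_congr e]
  exact H.prod_singleton _

/-- The letters of a word are its edges between consecutive vertices. -/
theorem ext_edges {n : ℕ} {v w : H.toSSet _⦋n⦌}
    (h : ∀ f : ⦋1⦌ ⟶ ⦋n⦌, H.toSSet.map f.op v = H.toSSet.map f.op w) : v = w := by
  have hv : v.1.length = n := v.2.2
  have hw : w.1.length = n := w.2.2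
  apply Subtype.ext
  apply List.ext_getElem (hv.trans hw.symm)
  intro i h1 h2
  have hin : i < n := hv ▸ h1
  have h3 := h (SimplexCategory.mkOfLe (Fin.castSucc ⟨i, hin⟩) (Fin.succ ⟨i, hin⟩)
    Fin.castSucc_lt_succ.le)
  rw [map_mkOfLe, map_mkOfLe] at h3
  have h4 := H.toEdge_bijective.1 h3
  rw [← H.sliceProd_succ v.1 v.2.1 i h1, ← H.sliceProd_succ w.1 w.2.1 i h2]
  exact h4

theorem hom_ext_edges {Z : SSet.{u}} {f g : Z ⟶ H.toSSet}
    (h : ∀ z : Z _⦋1⦌, f.app _ z = g.app _ z) : f = g := by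
  ext ⟨k⟩ z
  refine H.ext_edges (n := k.len) fun θ => ?_
  exact (NatTrans.naturality_apply f θ.op z).symm.trans
    ((h _).trans (NatTrans.naturality_apply g θ.op z))

end PartialGroup

/-! ### Rigidity of free partial groups -/

namespace FreePartialGroup

variable {X : Type u} {x₀ : X}

theorem bar_ne (a : {x : X // x ≠ x₀} × Bool) : bar a ≠ a := by
  rintro h
  have := congrArg Prod.snd h
  simp [bar] at this

theorem pair_mem_iff (a b : {x : X // x ≠ x₀} × Bool) :
    [some a, some b] ∈ (freePartialGroup X x₀).dom ↔ b = bar a := by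
  simp [freePartialGroup, dom, List.reduceOption]

theorem pair_none_mem (a : Carrier X x₀) : [a, none] ∈ (freePartialGroup X x₀).dom := by
  cases a <;> simp [freePartialGroup, dom, List.reduceOption]

theorem none_pair_mem (a : Carrier X x₀) : [none, a] ∈ (freePartialGroup X x₀).dom := by
  cases a <;> simp [freePartialGroup, dom, List.reduceOption]

theorem prod_pair_none (a : Carrier X x₀) (h : [a, none] ∈ (freePartialGroup X x₀).dom) :
    (freePartialGroup X x₀).prod _ h = a := by
  cases a <;> simp [freePartialGroup, altProd, List.reduceOption]

theorem prod_none_pair (a : Carrier X x₀) (h : [none, a] ∈ (freePartialGroup X x₀).dom) :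
    (freePartialGroup X x₀).prod _ h = a := by
  cases a <;> simp [freePartialGroup, altProd, List.reduceOption]

theorem prod_pair (a b : {x : X // x ≠ x₀} × Bool)
    (h : [some a, some b] ∈ (freePartialGroup X x₀).dom) :
    (freePartialGroup X x₀).prod _ h = none := by
  simp [freePartialGroup, altProd, List.reduceOption]

theorem one_eq : (freePartialGroup X x₀).one = none := rfl

/-- A nontrivial letter cannot be multiplied by itself, since `bar` has no fixed points. -/
theorem eq_none_of_forall_mem {c : Carrier X x₀}
    (h : ∀ a, [a, c] ∈ (freePartialGroup X x₀).dom) : c = none := by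
  cases c with
  | none => rfl
  | some c => exact absurd ((pair_mem_iff c c).1 (h (some c))).symm (bar_ne c)

/-- Let `g a y` be the value of the family on the edge `(a, y)` of the prism. The two degenerate
triangles with long edge `(a, y)` give $g(a,y_0)\,g(1,y)=g(a,y)=g(1,y)\,g(a,y_1)$. By invertibility
at $y_0$ the first factor runs through all elements, which forces $g(1,y)=1$; so `g a` takes the
same value on `y` and on both its endpoints. -/
theorem rigid : (freePartialGroup X x₀).toSSet.Rigid := by
  intro n Φ hΦ
  let M := freePartialGroup X x₀
  have hex : ∀ (a : Carrier X x₀) (y : (Δ[n] : SSet.{u}) _⦋1⦌),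
      ∃ c, Φ.app (.op ⦋1⦌) (M.toEdge a, y) = M.toEdge c := fun a y => by
    obtain ⟨c, hc⟩ := M.toEdge_bijective.2 (Φ.app (.op ⦋1⦌) (M.toEdge a, y))
    exact ⟨c, hc.symm⟩
  choose g hg using hex
  have hsurj : ∀ (p : Fin (n + 1)) (c : Carrier X x₀),
      ∃ a, g a (stdSimplex.const n p _) = c := by
    intro p c
    have := hΦ p
    have hb : Function.Bijective ((vertexInclusion M.toSSet n p ≫ Φ).app (.op ⦋1⦌)) := by
      rw [← isIso_iff_bijective]; infer_instance
    obtain ⟨w, hw⟩ := hb.2 (M.toEdge c)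
    obtain ⟨a, rfl⟩ := M.toEdge_bijective.2 w
    exact ⟨a, M.toEdge_bijective.1 ((hg a _).symm.trans hw)⟩
  have face : ∀ {s : M.toSSet _⦋2⦌} {t : (Δ[n] : SSet.{u}) _⦋2⦌} (f : ⦋1⦌ ⟶ ⦋2⦌)
      {a : Carrier X x₀} {y : (Δ[n] : SSet.{u}) _⦋1⦌}, M.toSSet.map f.op s = M.toEdge a →
      (Δ[n] : SSet.{u}).map f.op t = y →
      M.toSSet.map f.op (Φ.app (.op ⦋2⦌) (s, t)) = M.toEdge (g a y) := by
    intro s t f a y h1 h2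
    rw [← naturality_tensor, h1, h2, hg]
  have left : ∀ (a : Carrier X x₀) (y : (Δ[n] : SSet.{u}) _⦋1⦌),
      ∃ h : [g a (stdSimplex.const n (y 0) _), g none y] ∈ M.dom, M.prod _ h = g a y := by
    intro a y
    refine M.prod_eq_of_faces (w := Φ.app (.op ⦋2⦌) (M.toTriangle (pair_none_mem a),
      (Δ[n] : SSet.{u}).map (SimplexCategory.σ 0).op y)) (face _ (M.toTriangle_fst _) ?_)
      (face _ (M.toTriangle_snd _) ?_) (face _ ((M.toTriangle_prod _).trans
        (congrArg M.toEdge (prod_pair_none a _))) ?_) <;>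
    · apply SSet.stdSimplex.ext
      intro i
      fin_cases i <;> rfl
  have right : ∀ (a : Carrier X x₀) (y : (Δ[n] : SSet.{u}) _⦋1⦌),
      ∃ h : [g none y, g a (stdSimplex.const n (y 1) _)] ∈ M.dom, M.prod _ h = g a y := by
    intro a y
    refine M.prod_eq_of_faces (w := Φ.app (.op ⦋2⦌) (M.toTriangle (none_pair_mem a),
      (Δ[n] : SSet.{u}).map (SimplexCategory.σ 1).op y)) (face _ (M.toTriangle_fst _) ?_)
      (face _ (M.toTriangle_snd _) ?_) (face _ ((M.toTriangle_prod _).trans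
        (congrArg M.toEdge (prod_none_pair a _))) ?_) <;>
    · apply SSet.stdSimplex.ext
      intro i
      fin_cases i <;> rfl
  have hnone : ∀ y, g none y = none := by
    intro y
    apply eq_none_of_forall_mem
    intro c
    obtain ⟨a, rfl⟩ := hsurj (y 0) c
    exact (left a y).1
  have hleft : ∀ a y, g a (stdSimplex.const n (y 0) _) = g a y := by
    intro a y
    have h := left a y
    simp only [hnone] at h
    obtain ⟨h, e⟩ := h
    exact (prod_pair_none _ h).symm.trans e
  have hright : ∀ a y, g a (stdSimplex.const n (y 1) _) = g a y := by
    intro a y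
    have h := right a y
    simp only [hnone] at h
    obtain ⟨h, e⟩ := h
    exact (prod_none_pair _ h).symm.trans e
  -- The edge from `0` to the initial vertex of `y` links the values at these two vertices.
  have hconst : ∀ a y, g a y = g a (stdSimplex.const n 0 _) := by
    intro a y
    have h1 := hleft a (stdSimplex.edge n 0 (y 0) (Fin.zero_le _))
    have h2 := hright a (stdSimplex.edge n 0 (y 0) (Fin.zero_le _))
    exact (hleft a y).symm.trans (h2.trans h1.symm)
  apply M.hom_ext_edges
  rintro ⟨w, y⟩
  obtain ⟨a, rfl⟩ := M.toEdge_bijective.2 w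
  exact (hg a y).trans ((congrArg M.toEdge (hconst a y)).trans (hg a _).symm)

/-! ### Representations of free partial groups -/

theorem aut_some_false {F : SSet.{u}} (α : Monodromy (freePartialGroup X x₀) F)
    (x : {x : X // x ≠ x₀}) : α.aut (some (x, false)) = (α.aut (some (x, true))).symm := by
  have h : [some (x, true), some (x, false)] ∈ (freePartialGroup X x₀).dom :=
    (pair_mem_iff _ _).2 rfl
  have e := α.aut_prod _ _ h
  rw [prod_pair, ← one_eq, α.aut_one] at e
  have e2 := congrArg (fun i => (α.aut (some (x, true))).symm ≪≫ i) e
  simp only [Iso.symm_self_id_assoc, Iso.trans_refl] at e2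
  exact e2.symm

/-- Representations of a free partial group correspond to families of automorphisms. -/
def monodromyEquiv (F : SSet.{u}) :
    Monodromy (freePartialGroup X x₀) F ≃ ({x : X // x ≠ x₀} → (F ≅ F)) where
  toFun α x := α.aut (some (x, true))
  invFun g :=
    { aut := fun a => match a with
        | none => Iso.refl F
        | some (x, true) => g x
        | some (x, false) => (g x).symm
      -- A composable pair contains `1` or consists of mutually inverse letters, so the choice of
      -- `g` is subject to no relation.
      aut_prod := by
        intro a b h
        rcases a with _ | ⟨x, s⟩
        · rw [prod_none_pair, Iso.refl_trans]
        rcases b with _ | b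
        · rw [prod_pair_none, Iso.trans_refl]
        rw [prod_pair]
        obtain rfl := (pair_mem_iff _ _).1 h
        cases s
        · exact (Iso.symm_self_id _).symm
        · exact (Iso.self_symm_id _).symm }
  left_inv α := by
    ext1
    funext a
    rcases a with _ | ⟨x, _ | _⟩
    · exact α.aut_one.symm
    · exact (aut_some_false α x).symm
    · rfl
  right_inv g := rfl

/-! ### Automorphisms of free partial groups -/

/-- `altProd` sees only the length and the first letter, so no compatibility of `f` with `bar` is
needed. -/
theorem altProd_map (f : {x : X // x ≠ x₀} × Bool → {x : X // x ≠ x₀} × Bool)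
    (l : List ({x : X // x ≠ x₀} × Bool)) : altProd (l.map f) = (altProd l).map f := by
  simp only [altProd, List.length_map, List.head?_map]
  split_ifs <;> rfl

theorem map_mem_dom {f : {x : X // x ≠ x₀} × Bool → {x : X // x ≠ x₀} × Bool}
    (hf : ∀ a, f (bar a) = bar (f a)) {w : List (Carrier X x₀)} (hw : w ∈ dom X x₀) :
    w.map (Option.map f) ∈ dom X x₀ := by
  simp only [dom, Set.mem_ofPred_eq, List.reduceOption_map, List.isChain_map] at hw ⊢
  refine hw.imp ?_
  rintro a b rfl
  exact hf a

/-- The map of free partial groups defined by a map of letters that commutes with inversion. -/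
def mapSSet (f : {x : X // x ≠ x₀} × Bool → {x : X // x ≠ x₀} × Bool)
    (hf : ∀ a, f (bar a) = bar (f a)) :
    (freePartialGroup X x₀).toSSet ⟶ (freePartialGroup X x₀).toSSet where
  app k := ↾fun w => ⟨w.1.map (Option.map f), map_mem_dom hf w.2.1,
    (List.length_map _).trans w.2.2⟩
  naturality k l θ := by
    apply ConcreteCategory.hom_ext
    intro w
    apply Subtype.ext
    change ((freePartialGroup X x₀).pull w.1 w.2.1 θ.unop.toOrderHom).map (Option.map f) =
      (freePartialGroup X x₀).pull (w.1.map (Option.map f)) (map_mem_dom hf w.2.1)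
        θ.unop.toOrderHom
    simp only [PartialGroup.pull, List.map_ofFn]
    congr 1
    funext j
    change Option.map f (altProd (PartialGroup.slice w.1 _ _).reduceOption) =
      altProd (PartialGroup.slice (w.1.map (Option.map f)) _ _).reduceOption
    rw [PartialGroup.slice, PartialGroup.slice, ← List.map_take, ← List.map_drop,
      List.reduceOption_map, altProd_map]

/-- The permutations of the letters that commute with inversion. -/
abbrev SignedPerm (X : Type u) (x₀ : X) : Type u :=
  {σ : Equiv.Perm ({x : X // x ≠ x₀} × Bool) // ∀ a, σ (bar a) = bar (σ a)}

theorem symm_bar (σ : SignedPerm X x₀) (a : {x : X // x ≠ x₀} × Bool) :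
    σ.1.symm (bar a) = bar (σ.1.symm a) := by
  rw [Equiv.symm_apply_eq, σ.2, Equiv.apply_symm_apply]

theorem mapSSet_toEdge (f : {x : X // x ≠ x₀} × Bool → {x : X // x ≠ x₀} × Bool)
    (hf : ∀ a, f (bar a) = bar (f a)) (a : Carrier X x₀) :
    (mapSSet f hf).app (.op ⦋1⦌) ((freePartialGroup X x₀).toEdge a) =
      (freePartialGroup X x₀).toEdge (a.map f) := rfl

/-- The automorphism of a free partial group defined by a signed permutation. -/
def isoOfSignedPerm (σ : SignedPerm X x₀) :
    (freePartialGroup X x₀).toSSet ≅ (freePartialGroup X x₀).toSSet where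
  hom := mapSSet σ.1 σ.2
  inv := mapSSet σ.1.symm (symm_bar σ)
  hom_inv_id := by
    apply PartialGroup.hom_ext_edges
    intro w
    obtain ⟨a, rfl⟩ := (freePartialGroup X x₀).toEdge_bijective.2 w
    simp [mapSSet_toEdge]
  inv_hom_id := by
    apply PartialGroup.hom_ext_edges
    intro w
    obtain ⟨a, rfl⟩ := (freePartialGroup X x₀).toEdge_bijective.2 w
    simp [mapSSet_toEdge]

/-- An automorphism is determined by its permutation `u` of the edges. This fixes the degenerate
edge `1` and preserves composable pairs, hence commutes with `bar` on the remaining letters. -/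
theorem isoOfSignedPerm_bijective :
    Function.Bijective (isoOfSignedPerm (X := X) (x₀ := x₀)) := by
  let M := freePartialGroup X x₀
  refine ⟨fun σ τ h => ?_, fun ψ => ?_⟩
  · apply Subtype.ext
    apply Equiv.ext
    intro a
    have h1 := SSet.congr_app (congrArg Iso.hom h) (.op ⦋1⦌) (M.toEdge (some a))
    exact Option.some.inj (M.toEdge_bijective.1 h1)
  · let ε : Carrier X x₀ ≃ M.toSSet _⦋1⦌ := Equiv.ofBijective _ M.toEdge_bijective
    let ψ₁ : M.toSSet _⦋1⦌ ≃ M.toSSet _⦋1⦌ := (ψ.app (.op ⦋1⦌)).toEquiv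
    let u : Carrier X x₀ ≃ Carrier X x₀ := (ε.trans ψ₁).trans ε.symm
    have hu : ∀ a, ψ.hom.app (.op ⦋1⦌) (M.toEdge a) = M.toEdge (u a) := fun a =>
      (ε.apply_symm_apply (ψ₁ (ε a))).symm
    have hnone : u none = none := by
      apply M.toEdge_bijective.1
      rw [← hu, ← one_eq, ← M.map_vertex, NatTrans.naturality_apply]
      exact congrArg _ (M.toSSet_eq_const _)
    have hsome : ∀ a, some (Equiv.removeNone u a) = u (some a) := by
      intro a
      refine Equiv.removeNone_some u ?_
      rw [← Option.ne_none_iff_exists']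
      intro h
      exact Option.some_ne_none a (u.injective (h.trans hnone.symm))
    have hbar : ∀ a, Equiv.removeNone u (bar a) = bar (Equiv.removeNone u a) := by
      intro a
      have hmem : [some a, some (bar a)] ∈ M.dom := (pair_mem_iff _ _).2 rfl
      have face : ∀ (f : ⦋1⦌ ⟶ ⦋2⦌) {c : Carrier X x₀},
          M.toSSet.map f.op (M.toTriangle hmem) = M.toEdge c →
          M.toSSet.map f.op (ψ.hom.app (.op ⦋2⦌) (M.toTriangle hmem)) = M.toEdge (u c) := by
        intro f c h
        rw [← NatTrans.naturality_apply, h, hu]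
      obtain ⟨h, _⟩ := M.prod_eq_of_faces (face _ (M.toTriangle_fst hmem))
        (face _ (M.toTriangle_snd hmem)) (face _ (M.toTriangle_prod hmem))
      rw [← hsome, ← hsome] at h
      exact (pair_mem_iff _ _).1 h
    refine ⟨⟨Equiv.removeNone u, hbar⟩, ?_⟩
    ext1
    apply M.hom_ext_edges
    intro w
    obtain ⟨a, rfl⟩ := M.toEdge_bijective.2 w
    rw [hu]
    refine (mapSSet_toEdge _ hbar a).trans (congrArg M.toEdge ?_)
    cases a with
    | none => exact hnone.symm
    | some a => exact hsome a

/-- A signed permutation from a permutation and a choice of signs. -/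
def signedPerm (p : Equiv.Perm {x : X // x ≠ x₀} × ({x : X // x ≠ x₀} → Bool)) :
    SignedPerm X x₀ where
  val :=
    { toFun := fun a => (p.1 a.1, (p.2 a.1).xor a.2)
      invFun := fun a => (p.1.symm a.1, (p.2 (p.1.symm a.1)).xor a.2)
      left_inv := fun a => by simp
      right_inv := fun a => by simp }
  property a := by simp [bar]

theorem signedPerm_bijective : Function.Bijective (signedPerm (X := X) (x₀ := x₀)) := by
  constructor
  · rintro ⟨π, ε⟩ ⟨π', ε'⟩ h
    have key : ∀ x, (π x, (ε x).xor false) = (π' x, (ε' x).xor false) := fun x =>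
      DFunLike.congr_fun (congrArg Subtype.val h) (x, false)
    refine Prod.ext (Equiv.ext fun x => congrArg Prod.fst (key x)) (funext fun x => ?_)
    simpa using congrArg Prod.snd (key x)
  · intro σ
    -- Commuting with `bar` determines the value at `(x, true)` from the value at `(x, false)`.
    have hσ : ∀ x s, σ.1 (x, s) = ((σ.1 (x, false)).1, ((σ.1 (x, false)).2).xor s) := by
      intro x s
      cases s
      · simp
      · have := σ.2 (x, false)
        simpa [bar] using this
    have hbij : Function.Bijective fun x => (σ.1 (x, false)).1 := by
      constructor
      · intro x y h
        -- The second entries are chosen so that both images carry the sign `false`; injectivity of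
        -- `σ` then applies.
        have h1 : σ.1 (x, ((σ.1 (x, false)).2)) = σ.1 (y, ((σ.1 (y, false)).2)) := by
          rw [hσ x, hσ y]
          exact Prod.ext h (by simp)
        exact congrArg Prod.fst (σ.1.injective h1)
      · intro y
        refine ⟨(σ.1.symm (y, false)).1, ?_⟩
        have h := hσ (σ.1.symm (y, false)).1 (σ.1.symm (y, false)).2
        rw [Prod.mk.eta, Equiv.apply_symm_apply] at h
        exact (congrArg Prod.fst h).symm
    refine ⟨(Equiv.ofBijective _ hbij, fun x => (σ.1 (x, false)).2), ?_⟩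
    apply Subtype.ext
    apply Equiv.ext
    rintro ⟨x, s⟩
    exact (hσ x s).symm

theorem card_aut [Finite X] :
    Nat.card ((freePartialGroup X x₀).toSSet ≅ (freePartialGroup X x₀).toSSet) =
      Nat.factorial (Nat.card {x : X // x ≠ x₀}) * 2 ^ Nat.card {x : X // x ≠ x₀} := by
  rw [← Nat.card_congr (Equiv.ofBijective _ isoOfSignedPerm_bijective),
    ← Nat.card_congr (Equiv.ofBijective _ signedPerm_bijective), Nat.card_prod, Nat.card_perm,
    Nat.card_fun, Nat.card_eq_fintype_card (α := Bool), Fintype.card_bool]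

end FreePartialGroup

theorem mainTheorem2 (X Y : Type u) [Finite X] [Finite Y] (x₀ : X) (y₀ : Y) :
    Nat.card (ExtensionClasses (freePartialGroup X x₀) (freePartialGroup Y y₀)) =
      (Nat.factorial (Nat.card {y : Y // y ≠ y₀}) * 2 ^ Nat.card {y : Y // y ≠ y₀}) ^
        Nat.card {x : X // x ≠ x₀} := by
  rw [← Nat.card_congr (PartialGroupExtension.classesEquiv FreePartialGroup.rigid),
    Nat.card_congr (FreePartialGroup.monodromyEquiv _), Nat.card_fun, FreePartialGroup.card_aut]
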